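/- Consider the following game on the integers, in which some sites are occupied. At the start only the origin is occupied (by the first particle), and a second particle is dropped onto the origin. A fair coin is tossed repeatedly, the tosses being independent: heads moves the current particle one site to the right, tails one site to the left. As soon as the current particle reaches an unoccupied site it settles there, that site becomes occupied, and the next particle is dropped onto the origin. For $n\ge 2$, let $\Delta E_n$ denote the expected number of tosses made for the $n$-th particle, from when it is dropped until it settles, given that $n-1$ sites are occupied (only their number, not which sites they are). For $m\ge 1$ and $0\le j\le m-1$, let $\left\langle{m\atop j}\right\rangle$ be the Eulerian number, i.e. the number of permutations $w$ of $\{1,\dots,m\}$ with exactly $j$ descents (indices $1\le i<m$ with $w(i)>w(i+1)$). Then for every $n\ge 3$, \[ \Delta E_n=\sum_{k=1}^{n-1}\frac{\left\langle{n-1\atop k-1}\right\rangle}{(n-1)!}\cdot k(n-k)=\frac{1}{(n-1)!}\sum_{k=1}^{n-1}\left\langle{n-1\atop k-1}\right\rangle\cdot k(n-k). \] -/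

import Mathlib

open MeasureTheory ProbabilityTheory
open scoped ENNReal

namespace CoinGame

/-- A state of the coin-tossing game (one-dimensional internal diffusion limited aggregation):
the finite set of occupied sites, and the current position of the walking particle. -/
structure State where
  /-- the occupied sites -/
  occupied : Finset ℤ
  /-- the position of the particle that is currently walking -/
  particle : ℤ

/-- At the start exactly the origin is occupied, and a new particle has been dropped there. -/
def start : State := ⟨{0}, 0⟩

/-- One toss: heads (`true`) moves the walking particle one site to the right, tails (`false`)
one site to the left. If the site reached is occupied, the particle just stands there; otherwise
it settles there, occupying the site, and a new particle is dropped onto the origin. -/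
def State.toss (s : State) (heads : Bool) : State :=
  let x : ℤ := if heads then s.particle + 1 else s.particle - 1
  if x ∈ s.occupied then ⟨s.occupied, x⟩ else ⟨insert x s.occupied, 0⟩

/-- The state of the game after `t` tosses, where `c i` is the result of toss number `i`
(tosses are numbered from `0`). -/
def stateAfter (c : ℕ → Bool) : ℕ → State
  | 0 => start
  | t + 1 => (stateAfter c t).toss (c t)

/-- The number of occupied sites after `t` tosses. -/
def numOccupied (c : ℕ → Bool) (t : ℕ) : ℕ := (stateAfter c t).occupied.card

/-- The number of tosses made for the `n`-th particle (the particle at the origin at the start of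
the game being the first one). Toss number `t` moves the `n`-th particle exactly if `n - 1` sites
are occupied just before it, that is, after the tosses `0, …, t - 1`. The value is `⊤` if the
`n`-th particle is dropped but walks forever. -/
noncomputable def tossesFor (n : ℕ) (c : ℕ → Bool) : ℕ∞ :=
  {t : ℕ | numOccupied c t = n - 1}.encard

/-- The coin sequences for which at some time exactly `m` sites are occupied. -/
def Reaches (m : ℕ) (c : ℕ → Bool) : Prop := ∃ t, numOccupied c t = m

/-- `X 0, X 1, …` are independent tosses of a fair coin. -/
structure IsFairCoin {Ω : Type*} [MeasurableSpace Ω] (μ : Measure Ω) (X : ℕ → Ω → Bool) :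
    Prop where
  measurable : ∀ i, Measurable (X i)
  indep : iIndepFun X μ
  fair : ∀ i, μ {ω | X i ω = true} = 1 / 2

/-- The expected number of tosses for the `n`-th particle to settle, given that `n - 1` sites are
occupied: the expectation, in `[0, ∞]`, of the number of tosses made for the `n`-th particle,
under the conditional probability given that the game reaches `n - 1` occupied sites. -/
noncomputable def deltaE {Ω : Type*} [MeasurableSpace Ω] (μ : Measure Ω) (X : ℕ → Ω → Bool)
    (n : ℕ) : ℝ≥0∞ :=
  ∫⁻ ω, (tossesFor n (fun i => X i ω) : ℝ≥0∞)
    ∂(ProbabilityTheory.cond μ {ω | Reaches (n - 1) (fun i => X i ω)})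

/-- The descents of a permutation `w`: the indices `i` with `w i > w (i + 1)`. -/
def descents {n : ℕ} (w : Equiv.Perm (Fin n)) : Finset (Fin n) :=
  Finset.univ.filter (fun i => ∃ h : i.val + 1 < n, w ⟨i.val + 1, h⟩ < w i)

/-- The Eulerian number: the number of permutations of `n` letters with exactly `k` descents. -/
def eulerian (n k : ℕ) : ℕ :=
  (Finset.univ.filter (fun w : Equiv.Perm (Fin n) => (descents w).card = k)).card

end CoinGame

/-! The occupied sites always form a block `-l, …, r`. While they do, the particle performs a simple
random walk on the block, started at `0`: the mean exit time is `(l + 1) (r + 1)`, and the exit is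
on the right with probability `(l + 1) / (l + r + 2)`. So the pair `(l, r)` at successive levels
`l + r + 1 = 1, 2, …` is a Markov chain. Inserting the letter `m + 1` at a uniformly random position
into the word of a permutation of `m` letters with `r` descents leaves the number of descents
unchanged at `r + 1` of the `m + 1` positions and raises it by one at the others
(`sum_insertMax`). This is the same chain, so that at level `m` the number `r` is distributed as the
number of descents of a random permutation of `m` letters, and the expected number of tosses is the
Eulerian mean of `k (m + 1 - k)` with `k = r + 1`.

The proof replaces the strong Markov property by a potential: `meanTosses d l r x` is the
explicit expected number of tosses that will be made `d` levels above the current one. It satisfies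
the discrete Poisson equation `potential_eq_average`, hence the mean potential drops at each toss by
the probability that this toss is made at level `m` (`IsFairCoin.integral_potential`). Telescoping
bounds the expected number of tosses at each level, so the level tends to infinity in probability;
then the mean potential, which is bounded and vanishes above level `m`, tends to zero, and the
expected number of tosses is the potential of the initial state (`IsFairCoin.hasSum_measure`). In
particular every level is reached almost surely, and the conditioning in `deltaE` has no effect. The
potential of the initial state is evaluated by the insertion of largest letters
(`sum_meanTosses`). -/

namespace CoinGame

/-! ### Descents and the insertion of a largest letter -/

/-- The one-line word of `w` with the letter `-1` appended at every position from `n` on. For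
`n ≥ 1` the appended letter creates exactly one further descent, at position `n - 1`. -/
def letter {n : ℕ} (w : Equiv.Perm (Fin n)) (i : ℕ) : ℤ :=
  if h : i < n then ((w ⟨i, h⟩ : ℕ) : ℤ) else -1

/-- The descents of the word extended by the letter `-1`. -/
def extDescents {n : ℕ} (w : Equiv.Perm (Fin n)) : Finset ℕ :=
  (Finset.range n).filter (fun i => letter w (i + 1) < letter w i)

/-- The permutation whose word arises from that of `w` by inserting a new largest letter at
position `p`. -/
def insertMax {n : ℕ} (p : Fin (n + 1)) (w : Equiv.Perm (Fin n)) : Equiv.Perm (Fin (n + 1)) :=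
  (finSuccEquiv' p).trans ((Equiv.optionCongr w).trans (finSuccEquiv' (Fin.last n)).symm)

lemma insertMax_apply_self {n : ℕ} (p : Fin (n + 1)) (w : Equiv.Perm (Fin n)) :
    insertMax p w p = Fin.last n := by
  simp [insertMax]

lemma insertMax_apply_succAbove {n : ℕ} (p : Fin (n + 1)) (w : Equiv.Perm (Fin n)) (j : Fin n) :
    insertMax p w (p.succAbove j) = (w j).castSucc := by
  simp [insertMax]

lemma insertMax_bijective (n : ℕ) :
    Function.Bijective
      (fun q : Equiv.Perm (Fin n) × Fin (n + 1) => insertMax q.2 q.1) := by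
  rw [Fintype.bijective_iff_injective_and_card]
  constructor
  · rintro ⟨w, p⟩ ⟨w', p'⟩ h
    have h : insertMax p w = insertMax p' w' := h
    have hp : p = p' := by
      apply (insertMax p' w').injective
      rw [insertMax_apply_self, ← h, insertMax_apply_self]
    subst hp
    have hw : w = w' := by
      ext j
      have := congrArg (fun e : Equiv.Perm (Fin (n + 1)) => e (p.succAbove j)) h
      simp only [insertMax_apply_succAbove] at this
      exact congrArg Fin.val (Fin.castSucc_injective n this)
    rw [hw]
  · simp [Fintype.card_perm, Nat.factorial_succ, mul_comm]

lemma letter_lt {n : ℕ} (w : Equiv.Perm (Fin n)) (i : ℕ) : letter w i < n := by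
  unfold letter
  split_ifs with h
  · exact_mod_cast (w ⟨i, h⟩).isLt
  · omega

lemma letter_insertMax {n : ℕ} (p : Fin (n + 1)) (w : Equiv.Perm (Fin n)) (i : ℕ) :
    letter (insertMax p w) i =
      if i < p then letter w i else if i = p then (n : ℤ) else letter w (i - 1) := by
  by_cases hi : i < n + 1
  · have hl : letter (insertMax p w) i = ((insertMax p w ⟨i, hi⟩ : ℕ) : ℤ) := by
      simp [letter, hi]
    rw [hl]
    rcases Fin.eq_self_or_eq_succAbove p ⟨i, hi⟩ with h | ⟨j, h⟩
    · have hip : i = p := congrArg Fin.val h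
      rw [h, insertMax_apply_self]
      simp [hip]
    · rw [h, insertMax_apply_succAbove]
      have hv : i = (p.succAbove j : ℕ) := congrArg Fin.val h
      by_cases hj : j.castSucc < p
      · rw [Fin.succAbove_of_castSucc_lt _ _ hj] at hv
        have hj' : (j : ℕ) < p := hj
        simp only [Fin.val_castSucc] at hv
        subst hv
        simp [letter, hj']
      · rw [Fin.succAbove_of_le_castSucc _ _ (not_lt.mp hj)] at hv
        have hj' : (p : ℕ) ≤ j := not_lt.mp hj
        simp only [Fin.val_succ] at hv
        subst hv
        have h1 : ¬ (j : ℕ) + 1 < p := by omega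
        have h2 : ¬ (j : ℕ) + 1 = p := by omega
        simp [letter, h1, h2]
  · have hp := p.isLt
    have h1 : ¬ i < p := by omega
    have h2 : ¬ i = p := by omega
    have h3 : ¬ i - 1 < n := by omega
    simp [letter, h1, h2, h3, hi]

/-- Inserting the largest letter at position `p` destroys the descent at `p - 1`, if there is one,
and creates a descent at `p`; the other descents are kept, those from `p` on being shifted. -/
lemma extDescents_insertMax {n : ℕ} (p : Fin (n + 1)) (w : Equiv.Perm (Fin n)) :
    extDescents (insertMax p w) =
      insert (p : ℕ) (((extDescents w).filter (fun i => i + 1 ≠ (p : ℕ))).image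
        (fun i : ℕ => if i < (p : ℕ) then i else i + 1)) := by
  have hp := p.isLt
  ext i
  simp only [extDescents, Finset.mem_filter, Finset.mem_range, Finset.mem_insert,
    Finset.mem_image, letter_insertMax]
  constructor
  · rintro ⟨hi, hlt⟩
    rcases lt_trichotomy i (p : ℕ) with h | h | h
    · right
      by_cases h1 : i + 1 = p
      · rw [if_neg (by omega), if_pos h1, if_pos h] at hlt
        exact absurd hlt (not_lt.mpr (letter_lt w i).le)
      · rw [if_pos (by omega), if_pos h] at hlt
        exact ⟨i, ⟨⟨by omega, hlt⟩, h1⟩, if_pos h⟩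
    · exact Or.inl h
    · right
      rw [if_neg (by omega), if_neg (by omega), if_neg (by omega), if_neg (by omega)] at hlt
      refine ⟨i - 1, ⟨⟨by omega, ?_⟩, by omega⟩, ?_⟩
      · have : i - 1 + 1 = i + 1 - 1 := by omega
        rwa [this]
      · rw [if_neg (by omega)]; omega
  · rintro (rfl | ⟨k, ⟨⟨hk, hlt⟩, hkp⟩, rfl⟩)
    · refine ⟨hp, ?_⟩
      simpa using letter_lt w _
    · by_cases h : k < p
      · rw [if_pos h, if_pos (by omega), if_pos h]
        exact ⟨by omega, hlt⟩
      · rw [if_neg h, if_neg (by omega), if_neg (by omega), if_neg (by omega), if_neg (by omega)]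
        exact ⟨by omega, by simpa using hlt⟩

lemma card_extDescents_insertMax {n : ℕ} (p : Fin (n + 1)) (w : Equiv.Perm (Fin n)) :
    (extDescents (insertMax p w)).card =
      ((extDescents w).filter (fun i => i + 1 ≠ (p : ℕ))).card + 1 := by
  rw [extDescents_insertMax, Finset.card_insert_of_notMem, Finset.card_image_of_injective]
  · intro i j h
    dsimp only at h
    split_ifs at h <;> omega
  · simp only [Finset.mem_image, not_exists, not_and]
    intro i _ h
    split_ifs at h <;> omega

lemma extDescents_subset {n : ℕ} (w : Equiv.Perm (Fin n)) :
    extDescents w ⊆ Finset.range n := Finset.filter_subset _ _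

/-- Among the `n + 1` positions for the new largest letter, those just after an extended descent
keep the number of extended descents, and all others raise it by one. -/
lemma sum_insertMax {n : ℕ} (w : Equiv.Perm (Fin n)) (f : ℕ → ℝ) :
    ∑ p : Fin (n + 1), f (extDescents (insertMax p w)).card =
      ((extDescents w).card : ℝ) * f (extDescents w).card +
        ((n : ℝ) + 1 - ((extDescents w).card : ℝ)) * f ((extDescents w).card + 1) := by
  set S := extDescents w with hS
  set D := S.card with hD
  have hval : ∀ p : Fin (n + 1), f (extDescents (insertMax p w)).card =
      (if (p : ℕ) ∈ S.image (· + 1) then f D else f (D + 1)) := by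
    intro p
    rw [card_extDescents_insertMax, ← hS]
    split_ifs with h
    · obtain ⟨i, hi, hip⟩ := Finset.mem_image.mp h
      have : S.filter (fun k => k + 1 ≠ (p : ℕ)) = S.erase i := by
        ext k
        simp only [Finset.mem_filter, Finset.mem_erase]
        constructor
        · rintro ⟨h1, h2⟩; exact ⟨fun h => h2 (by rw [h]; exact hip), h1⟩
        · rintro ⟨h1, h2⟩; exact ⟨h2, fun h => h1 (by omega)⟩
      rw [this, Finset.card_erase_add_one hi]
    · have : S.filter (fun k => k + 1 ≠ (p : ℕ)) = S := by
        apply Finset.filter_true_of_mem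
        intro k hk hkp
        exact h (Finset.mem_image.mpr ⟨k, hk, hkp⟩)
      rw [this]
  have hsub : S.image (· + 1) ⊆ Finset.range (n + 1) := by
    intro k hk
    obtain ⟨i, hi, rfl⟩ := Finset.mem_image.mp hk
    have := Finset.mem_range.mp (extDescents_subset w hi)
    simp only [Finset.mem_range]
    omega
  have hcard : (S.image (· + 1)).card = D :=
    Finset.card_image_of_injective _ (add_left_injective 1)
  rw [Finset.sum_congr rfl (fun p _ => hval p),
    Fin.sum_univ_eq_sum_range (fun k => if k ∈ S.image (· + 1) then f D else f (D + 1)) (n + 1),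
    Finset.sum_ite, Finset.sum_const, Finset.sum_const, Finset.filter_mem_eq_inter,
    Finset.inter_eq_right.mpr hsub, hcard, Finset.filter_notMem_eq_sdiff,
    Finset.card_sdiff_of_subset hsub, hcard, Finset.card_range, nsmul_eq_mul, nsmul_eq_mul]
  have hle : D ≤ n + 1 := by
    rw [← hcard, ← Finset.card_range (n + 1)]; exact Finset.card_le_card hsub
  push_cast [Nat.cast_sub hle]
  ring

lemma card_extDescents {n : ℕ} (hn : 1 ≤ n) (w : Equiv.Perm (Fin n)) :
    (extDescents w).card = (descents w).card + 1 := by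
  have h : extDescents w = insert (n - 1) ((descents w).map Fin.valEmbedding) := by
    ext i
    simp only [extDescents, descents, Finset.mem_filter, Finset.mem_range, Finset.mem_insert,
      Finset.mem_map, Finset.mem_univ, true_and, Fin.valEmbedding_apply]
    constructor
    · rintro ⟨hi, hlt⟩
      by_cases h1 : i + 1 < n
      · right
        refine ⟨⟨i, hi⟩, ⟨h1, ?_⟩, rfl⟩
        simpa [letter, hi, h1] using hlt
      · left; omega
    · rintro (rfl | ⟨k, ⟨h1, hlt⟩, rfl⟩)
      · refine ⟨by omega, ?_⟩
        have h2 : n - 1 + 1 = n := by omega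
        have h3 : n - 1 < n := by omega
        simp only [letter, h2, h3, lt_irrefl, dite_true, dite_false]
        omega
      · refine ⟨k.isLt, ?_⟩
        simpa [letter, h1] using hlt
  rw [h, Finset.card_insert_of_notMem, Finset.card_map]
  simp only [descents, Finset.mem_map, Finset.mem_filter, Finset.mem_univ, true_and,
    Fin.valEmbedding_apply, not_exists, not_and]
  rintro k ⟨h1, _⟩ h2
  omega

lemma card_descents_lt {n : ℕ} (hn : 1 ≤ n) (w : Equiv.Perm (Fin n)) :
    (descents w).card < n := by
  have := Finset.card_le_card (extDescents_subset w)
  rw [card_extDescents hn, Finset.card_range] at this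
  exact this

/-- The recurrence of the Eulerian numbers, stated for the number of descents of all permutations
tested against an arbitrary function. -/
lemma sum_perm_succ {n : ℕ} (hn : 1 ≤ n) (f : ℕ → ℝ) :
    ∑ w : Equiv.Perm (Fin (n + 1)), f (descents w).card =
      ∑ w : Equiv.Perm (Fin n), (((descents w).card + 1 : ℝ) * f (descents w).card +
        ((n : ℝ) - (descents w).card) * f ((descents w).card + 1)) := by
  rw [← (Equiv.ofBijective _ (insertMax_bijective n)).sum_comp, Fintype.sum_prod_type]
  refine Finset.sum_congr rfl fun w _ => ?_
  have h := sum_insertMax w (fun k => f (k - 1))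
  simp only [card_extDescents hn, card_extDescents (Nat.le_add_left 1 n),
    Nat.add_sub_cancel] at h
  simp only [Equiv.ofBijective_apply]
  rw [h]
  push_cast
  ring

lemma sum_eulerian_mul (n : ℕ) (hn : 1 ≤ n) (f : ℕ → ℝ) :
    ∑ k ∈ Finset.Icc 1 n, (eulerian n (k - 1) : ℝ) * f (k - 1) =
      ∑ w : Equiv.Perm (Fin n), f (descents w).card := by
  have h1 : ∑ k ∈ Finset.Icc 1 n, (eulerian n (k - 1) : ℝ) * f (k - 1) =
      ∑ j ∈ Finset.range n, (eulerian n j : ℝ) * f j := by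
    rw [Finset.sum_bij' (fun k _ => k - 1) (fun j _ => j + 1)]
    · intro k hk; simp only [Finset.mem_Icc, Finset.mem_range] at *; omega
    · intro k hk; simp only [Finset.mem_Icc, Finset.mem_range] at *; omega
    · intro k hk; simp only [Finset.mem_Icc] at *; omega
    · intro k hk; omega
    · intro k hk; rfl
  rw [h1, ← Finset.sum_fiberwise_of_maps_to (s := Finset.univ) (t := Finset.range n)
    (g := fun w : Equiv.Perm (Fin n) => (descents w).card)
    (fun w _ => Finset.mem_range.mpr (card_descents_lt hn w))]
  refine Finset.sum_congr rfl fun j _ => ?_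
  rw [Finset.sum_congr rfl (g := fun _ => f j)
    (fun w hw => by rw [(Finset.mem_filter.mp hw).2]), Finset.sum_const, nsmul_eq_mul, eulerian]

/-! ### Expected numbers of tosses as a potential -/

/-- For the state in which the sites `-l, …, r` are occupied and the particle is at `x`, the
expected number of tosses that will be made while `l + r + 1 + d` sites are occupied.

For `d = 0` this is the mean exit time from `-l, …, r` of the simple random walk started at `x`.
For `d + 1` it is the mean over the site of exit, which is `r + 1` with probability
`(x + l + 1) / (l + r + 2)` and `-l - 1` otherwise. The position is a real number, so that the
formula also covers the two exit sites. -/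
noncomputable def meanTosses : ℕ → ℕ → ℕ → ℝ → ℝ
  | 0, l, r, x => (x + l + 1) * (r + 1 - x)
  | d + 1, l, r, x =>
    ((x + l + 1) * meanTosses d l (r + 1) 0 + (r + 1 - x) * meanTosses d (l + 1) r 0) /
      (l + r + 2)

lemma meanTosses_nonneg (d l r : ℕ) (x : ℝ) (h1 : -(l : ℝ) - 1 ≤ x) (h2 : x ≤ r + 1) :
    0 ≤ meanTosses d l r x := by
  induction d generalizing l r x with
  | zero => exact mul_nonneg (by linarith) (by linarith)
  | succ d ih =>
    have hl : (0 : ℝ) ≤ l := l.cast_nonneg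
    have hr : (0 : ℝ) ≤ r := r.cast_nonneg
    refine div_nonneg (add_nonneg (mul_nonneg (by linarith) (ih _ _ _ ?_ ?_))
      (mul_nonneg (by linarith) (ih _ _ _ ?_ ?_))) (by linarith) <;> push_cast <;> linarith

lemma meanTosses_le (d l r : ℕ) (x : ℝ) (h1 : -(l : ℝ) - 1 ≤ x) (h2 : x ≤ r + 1) :
    meanTosses d l r x ≤ ((l : ℝ) + r + d + 2) ^ 2 := by
  induction d generalizing l r x with
  | zero =>
    simp only [meanTosses]
    push_cast
    nlinarith [sq_nonneg (x + l + 1), sq_nonneg (r + 1 - x),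
      mul_nonneg (sub_nonneg.mpr h1) (sub_nonneg.mpr h2)]
  | succ d ih =>
    have hl : (0 : ℝ) ≤ l := l.cast_nonneg
    have hr : (0 : ℝ) ≤ r := r.cast_nonneg
    have e1 := ih l (r + 1) 0 (by linarith) (by push_cast; linarith)
    have e2 := ih (l + 1) r 0 (by push_cast; linarith) (by linarith)
    push_cast at e1 e2 ⊢
    simp only [meanTosses]
    rw [div_le_iff₀ (by linarith)]
    have e3 := mul_le_mul_of_nonneg_left e1 (show (0 : ℝ) ≤ x + l + 1 by linarith)
    have e4 := mul_le_mul_of_nonneg_left e2 (show (0 : ℝ) ≤ r + 1 - x by linarith)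
    calc _ ≤ _ := add_le_add e3 e4
      _ = _ := by ring

/-- Averaged over all permutations of `n` letters, with as many sites to the right of the origin
as there are descents, the mean number of tosses does not depend on `n`: inserting a largest letter
at a random position changes the number of descents just as a settling particle changes the number
of sites on the right. -/
lemma sum_meanTosses_succ {n : ℕ} (hn : 1 ≤ n) (d : ℕ) :
    ∑ w : Equiv.Perm (Fin (n + 1)),
        meanTosses d (n + 1 - 1 - (descents w).card) (descents w).card 0 =
      (n + 1) * ∑ w : Equiv.Perm (Fin n),
        meanTosses (d + 1) (n - 1 - (descents w).card) (descents w).card 0 := by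
  rw [sum_perm_succ hn (fun k => meanTosses d (n + 1 - 1 - k) k 0), Finset.mul_sum]
  refine Finset.sum_congr rfl fun w _ => ?_
  have hlt := card_descents_lt hn w
  obtain ⟨l, hl⟩ : ∃ l, n = l + (descents w).card + 1 := ⟨n - 1 - (descents w).card, by omega⟩
  generalize (descents w).card = r at *
  subst hl
  have h1 : l + r + 1 + 1 - 1 - r = l + 1 := by omega
  have h2 : l + r + 1 + 1 - 1 - (r + 1) = l := by omega
  have h3 : l + r + 1 - 1 - r = l := by omega
  rw [h1, h2, h3]
  simp only [meanTosses]
  push_cast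
  have : (l : ℝ) + r + 2 ≠ 0 := by positivity
  field_simp
  ring

lemma sum_meanTosses (m d : ℕ) :
    ∑ w : Equiv.Perm (Fin (m + 1)), meanTosses d (m - (descents w).card) (descents w).card 0 =
      ((m + 1).factorial : ℝ) * meanTosses (m + d) 0 0 0 := by
  induction m generalizing d with
  | zero =>
    have h : ∀ w : Equiv.Perm (Fin (0 + 1)), (descents w).card = 0 := fun w => by
      have := card_descents_lt le_rfl w
      omega
    simp [h]
  | succ m ih =>
    have h := sum_meanTosses_succ (Nat.le_add_left 1 m) d
    simp only [Nat.add_sub_cancel] at h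
    rw [h, ih, Nat.factorial_succ (m + 1), show m + (d + 1) = m + 1 + d by omega]
    push_cast
    ring

/-- The Eulerian mean of `k (m + 2 - k)` is the expected number of tosses made while `m + 1` sites
are occupied. -/
lemma sum_eulerian_eq_meanTosses (m : ℕ) :
    ∑ k ∈ Finset.Icc 1 (m + 1), (eulerian (m + 1) (k - 1) : ℝ) *
        ((k : ℝ) * (((m + 1 + 1 : ℕ) : ℝ) - k)) =
      ((m + 1).factorial : ℝ) * meanTosses m 0 0 0 := by
  have h := sum_meanTosses m 0
  rw [add_zero, ← sum_eulerian_mul (m + 1) (Nat.le_add_left 1 m)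
    (fun j => meanTosses 0 (m - j) j 0)] at h
  rw [← h]
  refine Finset.sum_congr rfl fun k hk => ?_
  obtain ⟨h1, h2⟩ := Finset.mem_Icc.mp hk
  obtain ⟨j, rfl⟩ : ∃ j, k = j + 1 := ⟨k - 1, by omega⟩
  have hj : j ≤ m := by omega
  simp only [Nat.add_sub_cancel, meanTosses]
  push_cast [Nat.cast_sub hj]
  ring

/-! ### The potential along the game -/

/-- The expected number of tosses still to be made while exactly `m` sites are occupied, when now
the sites `-l, …, r` are occupied and the particle is at `x`. -/
noncomputable def blockPotential (m l r : ℕ) (x : ℝ) : ℝ :=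
  if l + r + 1 ≤ m then meanTosses (m - (l + r + 1)) l r x else 0

lemma blockPotential_exit_right (m l r : ℕ) :
    blockPotential m l r (r + 1) = blockPotential m l (r + 1) 0 := by
  unfold blockPotential
  rcases lt_trichotomy (l + r + 1) m with h | h | h
  · rw [if_pos h.le, if_pos (by omega),
      show m - (l + r + 1) = (m - (l + (r + 1) + 1)) + 1 by omega]
    simp only [meanTosses]
    have : (l : ℝ) + r + 2 ≠ 0 := by positivity
    field_simp
    ring
  · rw [if_pos h.le, if_neg (by omega), show m - (l + r + 1) = 0 by omega]
    simp [meanTosses]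
  · rw [if_neg (by omega), if_neg (by omega)]

lemma blockPotential_exit_left (m l r : ℕ) :
    blockPotential m l r (-l - 1) = blockPotential m (l + 1) r 0 := by
  unfold blockPotential
  rcases lt_trichotomy (l + r + 1) m with h | h | h
  · rw [if_pos h.le, if_pos (by omega),
      show m - (l + r + 1) = (m - (l + 1 + r + 1)) + 1 by omega]
    simp only [meanTosses]
    have : (l : ℝ) + r + 2 ≠ 0 := by positivity
    field_simp
    ring
  · rw [if_pos h.le, if_neg (by omega), show m - (l + r + 1) = 0 by omega]
    simp only [meanTosses]
    ring
  · rw [if_neg (by omega), if_neg (by omega)]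

/-- The discrete Poisson equation: the potential is quadratic in the position at level `m` and
affine below that level. -/
lemma blockPotential_eq_average (m l r : ℕ) (x : ℝ) :
    blockPotential m l r x = (if l + r + 1 = m then 1 else 0) +
      (blockPotential m l r (x + 1) + blockPotential m l r (x - 1)) / 2 := by
  unfold blockPotential
  rcases lt_trichotomy (l + r + 1) m with h | h | h
  · rw [if_pos h.le, if_neg (by omega), if_pos h.le, if_pos h.le,
      show m - (l + r + 1) = (m - (l + r + 1) - 1) + 1 by omega]
    simp only [meanTosses]
    ring
  · rw [if_pos h.le, if_pos h, if_pos h.le, if_pos h.le, show m - (l + r + 1) = 0 by omega]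
    simp only [meanTosses]
    ring
  · rw [if_neg (by omega), if_neg (by omega), if_neg (by omega), if_neg (by omega)]
    ring

lemma blockPotential_nonneg (m l r : ℕ) (x : ℝ) (h1 : -(l : ℝ) - 1 ≤ x) (h2 : x ≤ r + 1) :
    0 ≤ blockPotential m l r x := by
  unfold blockPotential
  split_ifs
  · exact meanTosses_nonneg _ _ _ _ h1 h2
  · exact le_rfl

lemma blockPotential_le (m l r : ℕ) (x : ℝ) (h1 : -(l : ℝ) - 1 ≤ x) (h2 : x ≤ r + 1) :
    blockPotential m l r x ≤ ((m : ℝ) + 1) ^ 2 * (if l + r + 1 ≤ m then 1 else 0) := by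
  unfold blockPotential
  split_ifs with h
  · refine (meanTosses_le _ _ _ _ h1 h2).trans (le_of_eq ?_)
    push_cast [Nat.cast_sub h]
    ring
  · simp

/-- The occupied sites form a block `-l, …, r` around the origin, and the particle is in it. -/
def IsBlock (s : State) : Prop :=
  ∃ l r : ℕ, s.occupied = Finset.Icc (-(l : ℤ)) r ∧ -(l : ℤ) ≤ s.particle ∧ s.particle ≤ r

/-- The block potential of a state, as a function of all states: `l` and `r` are read off as the
numbers of negative and of positive occupied sites. -/
noncomputable def potential (m : ℕ) (s : State) : ℝ :=
  blockPotential m (s.occupied.filter (· < 0)).card (s.occupied.filter (0 < ·)).card s.particle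

lemma potential_block (m l r : ℕ) (x : ℤ) :
    potential m ⟨Finset.Icc (-(l : ℤ)) r, x⟩ = blockPotential m l r x := by
  have h1 : (Finset.Icc (-(l : ℤ)) r).filter (· < 0) = Finset.Ico (-(l : ℤ)) 0 := by
    ext i; simp only [Finset.mem_filter, Finset.mem_Icc, Finset.mem_Ico]; omega
  have h2 : (Finset.Icc (-(l : ℤ)) r).filter (0 < ·) = Finset.Ioc 0 (r : ℤ) := by
    ext i; simp only [Finset.mem_filter, Finset.mem_Icc, Finset.mem_Ioc]; omega
  simp [potential, h1, h2]

lemma card_block (l r : ℕ) : (Finset.Icc (-(l : ℤ)) r).card = l + r + 1 := by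
  rw [Int.card_Icc]; omega

lemma insert_right_block (l r : ℕ) :
    insert ((r : ℤ) + 1) (Finset.Icc (-(l : ℤ)) r) = Finset.Icc (-(l : ℤ)) (r + 1 : ℕ) := by
  ext i; simp only [Finset.mem_insert, Finset.mem_Icc]; omega

lemma insert_left_block (l r : ℕ) :
    insert (-(l : ℤ) - 1) (Finset.Icc (-(l : ℤ)) r) = Finset.Icc (-(l + 1 : ℕ) : ℤ) r := by
  ext i; simp only [Finset.mem_insert, Finset.mem_Icc]; omega

lemma toss_block_true (l r : ℕ) (x : ℤ) (h1 : -(l : ℤ) ≤ x) (h2 : x ≤ r) :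
    State.toss ⟨Finset.Icc (-(l : ℤ)) r, x⟩ true =
      if x = r then ⟨Finset.Icc (-(l : ℤ)) (r + 1 : ℕ), 0⟩
      else ⟨Finset.Icc (-(l : ℤ)) r, x + 1⟩ := by
  unfold State.toss
  simp only [if_true, Finset.mem_Icc]
  split_ifs with h h' h'
  · omega
  · rfl
  · rw [h', insert_right_block]
  · omega

lemma toss_block_false (l r : ℕ) (x : ℤ) (h1 : -(l : ℤ) ≤ x) (h2 : x ≤ r) :
    State.toss ⟨Finset.Icc (-(l : ℤ)) r, x⟩ false =
      if x = -l then ⟨Finset.Icc (-(l + 1 : ℕ) : ℤ) r, 0⟩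
      else ⟨Finset.Icc (-(l : ℤ)) r, x - 1⟩ := by
  unfold State.toss
  simp only [Bool.false_eq_true, if_false, Finset.mem_Icc]
  split_ifs with h h' h'
  · omega
  · rfl
  · rw [h', insert_left_block]
  · omega

lemma IsBlock.toss {s : State} (hs : IsBlock s) (b : Bool) : IsBlock (s.toss b) := by
  obtain ⟨A, x⟩ := s
  obtain ⟨l, r, hA, h1, h2⟩ := hs
  dsimp only at hA h1 h2
  subst hA
  cases b
  · rw [toss_block_false l r x h1 h2]
    split_ifs with h
    · exact ⟨l + 1, r, rfl, by dsimp only; omega, by simp⟩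
    · exact ⟨l, r, rfl, by dsimp only; omega, by dsimp only; omega⟩
  · rw [toss_block_true l r x h1 h2]
    split_ifs with h
    · exact ⟨l, r + 1, rfl, by simp, by dsimp only; omega⟩
    · exact ⟨l, r, rfl, by dsimp only; omega, by dsimp only; omega⟩

lemma isBlock_stateAfter (c : ℕ → Bool) (t : ℕ) : IsBlock (stateAfter c t) := by
  induction t with
  | zero => exact ⟨0, 0, by simp [stateAfter, start], by simp [stateAfter, start],
      by simp [stateAfter, start]⟩
  | succ t ih => exact ih.toss _

lemma potential_start (m : ℕ) : potential (m + 1) start = meanTosses m 0 0 0 := by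
  have h := potential_block (m + 1) 0 0 0
  have hs : start = ⟨Finset.Icc (-((0 : ℕ) : ℤ)) (0 : ℕ), 0⟩ := by simp [start]
  rw [hs, h]
  simp [blockPotential]

lemma potential_eq_average (m : ℕ) {s : State} (hs : IsBlock s) :
    potential m s = (if s.occupied.card = m then 1 else 0) +
      (potential m (s.toss true) + potential m (s.toss false)) / 2 := by
  obtain ⟨A, x⟩ := s
  obtain ⟨l, r, hA, h1, h2⟩ := hs
  dsimp only at hA h1 h2
  subst hA
  have ht : potential m (State.toss ⟨Finset.Icc (-(l : ℤ)) r, x⟩ true) =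
      blockPotential m l r (x + 1) := by
    rw [toss_block_true l r x h1 h2]
    split_ifs with h
    · rw [potential_block, h]
      simpa using (blockPotential_exit_right m l r).symm
    · rw [potential_block]; push_cast; rfl
  have hf : potential m (State.toss ⟨Finset.Icc (-(l : ℤ)) r, x⟩ false) =
      blockPotential m l r (x - 1) := by
    rw [toss_block_false l r x h1 h2]
    split_ifs with h
    · rw [potential_block, h]
      simpa using (blockPotential_exit_left m l r).symm
    · rw [potential_block]; push_cast; rfl
  rw [ht, hf, potential_block, card_block]
  exact blockPotential_eq_average m l r x

lemma potential_nonneg (m : ℕ) {s : State} (hs : IsBlock s) : 0 ≤ potential m s := by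
  obtain ⟨A, x⟩ := s
  obtain ⟨l, r, hA, h1, h2⟩ := hs
  dsimp only at hA h1 h2
  subst hA
  have h1' : (-(l : ℝ)) ≤ x := by exact_mod_cast h1
  have h2' : (x : ℝ) ≤ r := by exact_mod_cast h2
  rw [potential_block]
  exact blockPotential_nonneg _ _ _ _ (by linarith) (by linarith)

lemma potential_le (m : ℕ) {s : State} (hs : IsBlock s) :
    potential m s ≤ ((m : ℝ) + 1) ^ 2 * (if s.occupied.card ≤ m then 1 else 0) := by
  obtain ⟨A, x⟩ := s
  obtain ⟨l, r, hA, h1, h2⟩ := hs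
  dsimp only at hA h1 h2
  subst hA
  have h1' : (-(l : ℝ)) ≤ x := by exact_mod_cast h1
  have h2' : (x : ℝ) ≤ r := by exact_mod_cast h2
  rw [potential_block, card_block]
  exact blockPotential_le _ _ _ _ (by linarith) (by linarith)

lemma one_le_card {s : State} (hs : IsBlock s) : 1 ≤ s.occupied.card := by
  obtain ⟨l, r, hA, -, -⟩ := hs
  rw [hA, card_block]
  omega

lemma card_toss_le (s : State) (b : Bool) :
    (s.toss b).occupied.card ≤ s.occupied.card + 1 := by
  unfold State.toss
  generalize (if b = true then s.particle + 1 else s.particle - 1) = x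
  dsimp only
  split_ifs with h
  · exact Nat.le_succ _
  · rw [Finset.card_insert_of_notMem h]

/-- The number of occupied sites grows by steps of at most one, so it skips no value. -/
lemma reaches_of_le_numOccupied {c : ℕ → Bool} {m t : ℕ} (hm : 1 ≤ m)
    (h : m ≤ numOccupied c t) : Reaches m c := by
  induction t with
  | zero => exact ⟨0, le_antisymm (by simpa [numOccupied, stateAfter, start] using hm) h⟩
  | succ t ih =>
    by_cases h' : m ≤ numOccupied c t
    · exact ih h'
    · have := card_toss_le (stateAfter c t) (c t)
      exact ⟨t + 1, le_antisymm (by unfold numOccupied at *; simp only [stateAfter]; omega) h⟩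

/-! ### Expectations along the game -/

lemma stateAfter_congr {c c' : ℕ → Bool} {t : ℕ} (h : ∀ i < t, c i = c' i) :
    stateAfter c t = stateAfter c' t := by
  induction t with
  | zero => rfl
  | succ t ih =>
    simp only [stateAfter]
    rw [ih fun i hi => h i (hi.trans (Nat.lt_succ_self t)), h t (Nat.lt_succ_self t)]

/-- The state after `t` tosses as a function of these tosses only. -/
def stateOfPrefix (t : ℕ) (y : Finset.range t → Bool) : State :=
  stateAfter (fun i => if h : i ∈ Finset.range t then y ⟨i, h⟩ else false) t

lemma stateAfter_eq_stateOfPrefix (c : ℕ → Bool) (t : ℕ) :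
    stateAfter c t = stateOfPrefix t (fun i => c i) := by
  refine stateAfter_congr fun i hi => ?_
  rw [dif_pos (Finset.mem_range.mpr hi)]

section Expectation

variable {Ω : Type*} [MeasurableSpace Ω] {μ : Measure Ω} {X : ℕ → Ω → Bool}

lemma IsFairCoin.measurable_stateAfter (hX : IsFairCoin μ X) {β : Type*} [MeasurableSpace β]
    (F : State → β) (t : ℕ) : Measurable (fun ω => F (stateAfter (fun i => X i ω) t)) := by
  simp_rw [stateAfter_eq_stateOfPrefix]
  exact (measurable_of_finite (fun y => F (stateOfPrefix t y))).comp
    (measurable_pi_lambda _ fun i => hX.measurable i)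

lemma IsFairCoin.measurableSet_numOccupied (hX : IsFairCoin μ X) (p : ℕ → Prop) (t : ℕ) :
    MeasurableSet {ω | p (numOccupied (fun i => X i ω) t)} :=
  measurableSet_setOfPred.mpr (hX.measurable_stateAfter (fun s => p s.occupied.card) t)

lemma IsFairCoin.integral_numOccupied (hX : IsFairCoin μ X) (p : ℕ → Prop) [DecidablePred p]
    (t : ℕ) :
    ∫ ω, (if p (stateAfter (fun i => X i ω) t).occupied.card then (1 : ℝ) else 0) ∂μ =
      μ.real {ω | p (numOccupied (fun i => X i ω) t)} := by
  rw [← integral_indicator_one (hX.measurableSet_numOccupied p t)]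
  refine integral_congr_ae (Filter.Eventually.of_forall fun ω => ?_)
  by_cases h : p (stateAfter (fun i => X i ω) t).occupied.card <;> simp [h, numOccupied]

variable [IsProbabilityMeasure μ]

lemma IsFairCoin.integrable_stateAfter (hX : IsFairCoin μ X) (F : State → ℝ) (t : ℕ) :
    Integrable (fun ω => F (stateAfter (fun i => X i ω) t)) μ := by
  simp_rw [stateAfter_eq_stateOfPrefix]
  have hm : Measurable (fun ω (i : Finset.range t) => X i ω) :=
    measurable_pi_lambda _ fun i => hX.measurable i
  have : IsProbabilityMeasure (μ.map (fun ω (i : Finset.range t) => X i ω)) :=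
    Measure.isProbabilityMeasure_map hm.aemeasurable
  exact (Integrable.of_finite (f := fun y => F (stateOfPrefix t y))).comp_measurable hm

lemma IsFairCoin.measure_eq (hX : IsFairCoin μ X) (t : ℕ) (b : Bool) :
    μ.real {ω | X t ω = b} = 1 / 2 := by
  have htrue : μ.real {ω | X t ω = true} = 1 / 2 := by
    simp [Measure.real, hX.fair t]
  cases b
  · have hc : {ω | X t ω = false} = {ω | X t ω = true}ᶜ := by
      ext ω; simp
    have hm : MeasurableSet {ω | X t ω = true} :=
      hX.measurable t (measurableSet_singleton true)
    rw [hc, probReal_compl_eq_one_sub hm, htrue]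
    norm_num
  · exact htrue

/-- The result of toss number `t` is independent of the state after `t` tosses. -/
lemma IsFairCoin.integral_toss_eq (hX : IsFairCoin μ X) (G : State → ℝ) (t : ℕ) (b : Bool) :
    ∫ ω, G (stateAfter (fun i => X i ω) t) * (if X t ω = b then 1 else 0) ∂μ =
      (∫ ω, G (stateAfter (fun i => X i ω) t) ∂μ) / 2 := by
  have hind := hX.indep.indepFun_finset (Finset.range t) {t} (by simp) hX.measurable
  have hind' := hind.comp (φ := fun y => G (stateOfPrefix t y))
    (ψ := fun y => if y ⟨t, Finset.mem_singleton_self t⟩ = b then (1 : ℝ) else 0)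
    (measurable_of_finite _) (measurable_of_finite _)
  have hb : Measurable (fun ω => if X t ω = b then (1 : ℝ) else 0) :=
    (measurable_of_finite (fun y : Bool => if y = b then (1 : ℝ) else 0)).comp (hX.measurable t)
  have hint : ∫ ω, (if X t ω = b then (1 : ℝ) else 0) ∂μ = 1 / 2 := by
    have hm : MeasurableSet {ω | X t ω = b} := hX.measurable t (measurableSet_singleton b)
    rw [← hX.measure_eq t b, ← integral_indicator_one hm]
    refine integral_congr_ae (Filter.Eventually.of_forall fun ω => ?_)
    by_cases h : X t ω = b <;> simp [h]
  have h := IndepFun.integral_fun_mul_eq_mul_integral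
    (X := fun ω => G (stateAfter (fun i => X i ω) t))
    (Y := fun ω => if X t ω = b then (1 : ℝ) else 0) (μ := μ)
    (by simp_rw [stateAfter_eq_stateOfPrefix]; exact hind')
    (hX.measurable_stateAfter G t).aestronglyMeasurable hb.aestronglyMeasurable
  rw [h, hint]
  ring

lemma IsFairCoin.integral_stateAfter_succ (hX : IsFairCoin μ X) (F : State → ℝ) (t : ℕ) :
    ∫ ω, F (stateAfter (fun i => X i ω) (t + 1)) ∂μ =
      ∫ ω, (F ((stateAfter (fun i => X i ω) t).toss true) +
        F ((stateAfter (fun i => X i ω) t).toss false)) / 2 ∂μ := by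
  have hsplit : ∀ ω, F (stateAfter (fun i => X i ω) (t + 1)) =
      F ((stateAfter (fun i => X i ω) t).toss true) * (if X t ω = true then 1 else 0) +
        F ((stateAfter (fun i => X i ω) t).toss false) * (if X t ω = false then 1 else 0) := by
    intro ω
    simp only [stateAfter]
    cases X t ω <;> simp
  have hb : ∀ b, Measurable (fun ω => if X t ω = b then (1 : ℝ) else 0) := fun b =>
    (measurable_of_finite (fun y : Bool => if y = b then (1 : ℝ) else 0)).comp (hX.measurable t)
  have hi : ∀ b, Integrable (fun ω => F ((stateAfter (fun i => X i ω) t).toss b) *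
      (if X t ω = b then 1 else 0)) μ := by
    intro b
    refine (hX.integrable_stateAfter (fun s => F (s.toss b)) t).mul_bdd (c := 1)
      (hb b).aestronglyMeasurable (Filter.Eventually.of_forall fun ω => ?_)
    split_ifs <;> simp
  simp_rw [hsplit]
  rw [integral_add (hi true) (hi false), hX.integral_toss_eq (fun s => F (s.toss true)),
    hX.integral_toss_eq (fun s => F (s.toss false)), integral_div,
    integral_add (hX.integrable_stateAfter (fun s => F (s.toss true)) t)
      (hX.integrable_stateAfter (fun s => F (s.toss false)) t)]
  ring

/-- The mean potential decreases, at each toss, by the probability that this toss is counted. -/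
lemma IsFairCoin.integral_potential (hX : IsFairCoin μ X) (m t : ℕ) :
    ∫ ω, potential m (stateAfter (fun i => X i ω) t) ∂μ =
      μ.real {ω | numOccupied (fun i => X i ω) t = m} +
        ∫ ω, potential m (stateAfter (fun i => X i ω) (t + 1)) ∂μ := by
  rw [hX.integral_stateAfter_succ, ← hX.integral_numOccupied (fun k => k = m),
    ← integral_add (hX.integrable_stateAfter (fun s => if s.occupied.card = m then 1 else 0) t)
      (hX.integrable_stateAfter
        (fun s => (potential m (s.toss true) + potential m (s.toss false)) / 2) t)]
  exact integral_congr_ae (Filter.Eventually.of_forall fun ω =>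
    potential_eq_average m (isBlock_stateAfter _ t))

lemma IsFairCoin.sum_range_measure (hX : IsFairCoin μ X) (m T : ℕ) :
    ∑ t ∈ Finset.range T, μ.real {ω | numOccupied (fun i => X i ω) t = m} =
      potential m start - ∫ ω, potential m (stateAfter (fun i => X i ω) T) ∂μ := by
  induction T with
  | zero => simp [stateAfter]
  | succ T ih =>
    rw [Finset.sum_range_succ, ih, hX.integral_potential m T]
    ring

lemma IsFairCoin.summable_measure (hX : IsFairCoin μ X) (m : ℕ) :
    Summable fun t => μ.real {ω | numOccupied (fun i => X i ω) t = m} := by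
  refine summable_of_sum_range_le (c := potential m start) (fun _ => measureReal_nonneg)
    fun T => ?_
  rw [hX.sum_range_measure]
  exact sub_le_self _ (integral_nonneg fun ω => potential_nonneg m (isBlock_stateAfter _ T))

/-- As only finitely many tosses are to be expected at each level, the number of occupied sites
tends to infinity in probability. -/
lemma IsFairCoin.tendsto_measure_le (hX : IsFairCoin μ X) (m : ℕ) :
    Filter.Tendsto (fun t => μ.real {ω | numOccupied (fun i => X i ω) t ≤ m})
      Filter.atTop (nhds 0) := by
  induction m with
  | zero =>
    have h : ∀ t, {ω | numOccupied (fun i => X i ω) t ≤ 0} = ∅ := fun t => by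
      ext ω
      have := one_le_card (isBlock_stateAfter (fun i => X i ω) t)
      simp only [numOccupied, Set.mem_ofPred_eq, Set.mem_empty_iff_false, iff_false]
      omega
    simp_rw [h]
    simp
  | succ m ih =>
    have h := ih.add (hX.summable_measure (m + 1)).tendsto_atTop_zero
    rw [add_zero] at h
    refine squeeze_zero (fun _ => measureReal_nonneg) (fun t => ?_) h
    refine (measureReal_mono ?_).trans (measureReal_union_le _ _)
    intro ω hω
    exact Nat.le_succ_iff.mp hω

lemma IsFairCoin.tendsto_integral_potential (hX : IsFairCoin μ X) (m : ℕ) :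
    Filter.Tendsto (fun t => ∫ ω, potential m (stateAfter (fun i => X i ω) t) ∂μ)
      Filter.atTop (nhds 0) := by
  have h := (hX.tendsto_measure_le m).const_mul (((m : ℝ) + 1) ^ 2)
  rw [mul_zero] at h
  refine squeeze_zero
    (fun t => integral_nonneg fun ω => potential_nonneg m (isBlock_stateAfter _ t))
    (fun t => ?_) h
  rw [← hX.integral_numOccupied (fun k => k ≤ m), ← integral_const_mul]
  exact integral_mono (hX.integrable_stateAfter _ t)
    ((hX.integrable_stateAfter (fun s => if s.occupied.card ≤ m then 1 else 0) t).const_mul _)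
    fun ω => potential_le m (isBlock_stateAfter _ t)

lemma IsFairCoin.hasSum_measure (hX : IsFairCoin μ X) (m : ℕ) :
    HasSum (fun t => μ.real {ω | numOccupied (fun i => X i ω) t = m}) (potential m start) := by
  rw [hasSum_iff_tendsto_nat_of_nonneg fun _ => measureReal_nonneg]
  simp_rw [hX.sum_range_measure]
  simpa using (hX.tendsto_integral_potential m).const_sub (potential m start)

lemma IsFairCoin.ae_reaches (hX : IsFairCoin μ X) {m : ℕ} (hm : 1 ≤ m) :
    ∀ᵐ ω ∂μ, Reaches m (fun i => X i ω) := by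
  have h : μ.real {ω | ¬ Reaches m (fun i => X i ω)} ≤ 0 := by
    refine ge_of_tendsto' (hX.tendsto_measure_le m) fun t => measureReal_mono fun ω hω => ?_
    by_contra hlt
    exact hω (reaches_of_le_numOccupied hm (not_le.mp hlt).le)
  rw [ae_iff]
  exact (measureReal_eq_zero_iff).mp (le_antisymm h measureReal_nonneg)

lemma IsFairCoin.cond_reaches (hX : IsFairCoin μ X) {m : ℕ} (hm : 1 ≤ m) :
    ProbabilityTheory.cond μ {ω | Reaches m (fun i => X i ω)} = μ := by
  have h : ∀ᵐ ω ∂μ, ω ∈ {ω | Reaches m (fun i => X i ω)} := hX.ae_reaches hm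
  have h1 : μ {ω | Reaches m (fun i => X i ω)} = 1 := by
    rw [measure_eq_measure_of_null_sdiff (Set.subset_univ _), measure_univ]
    rw [← Set.compl_eq_univ_sdiff]
    exact h
  rw [ProbabilityTheory.cond, Measure.restrict_eq_self_of_ae_mem h, h1, inv_one, one_smul]

lemma tossesFor_eq_tsum (n : ℕ) (c : ℕ → Bool) :
    (tossesFor n c : ℝ≥0∞) =
      ∑' t, {t : ℕ | numOccupied c t = n - 1}.indicator (fun _ => (1 : ℝ≥0∞)) t := by
  rw [tossesFor, ← Measure.count_apply (MeasurableSet.of_discrete), ← lintegral_indicator_one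
    MeasurableSet.of_discrete, lintegral_count]
  rfl

lemma IsFairCoin.deltaE_eq_potential (hX : IsFairCoin μ X) {n : ℕ} (hn : 2 ≤ n) :
    deltaE μ X n = ENNReal.ofReal (potential (n - 1) start) := by
  have hset := fun t => hX.measurableSet_numOccupied (fun k => k = n - 1) t
  rw [deltaE, hX.cond_reaches (by omega)]
  simp_rw [tossesFor_eq_tsum]
  have hind : ∀ t ω, {t : ℕ | numOccupied (fun i => X i ω) t = n - 1}.indicator
      (fun _ => (1 : ℝ≥0∞)) t =
        {ω | numOccupied (fun i => X i ω) t = n - 1}.indicator (fun _ => (1 : ℝ≥0∞)) ω :=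
    fun t ω => rfl
  simp_rw [hind]
  rw [lintegral_tsum fun t => (measurable_const.indicator (hset t)).aemeasurable]
  simp_rw [fun t => lintegral_indicator_const (μ := μ) (hset t) 1, one_mul]
  rw [← (hX.hasSum_measure (n - 1)).tsum_eq,
    ENNReal.ofReal_tsum_of_nonneg (fun _ => measureReal_nonneg) (hX.summable_measure (n - 1))]
  exact tsum_congr fun t => (ofReal_measureReal).symm

end Expectation

end CoinGame

theorem corollary1 {Ω : Type*} [MeasurableSpace Ω] (μ : Measure Ω) [IsProbabilityMeasure μ]
    (X : ℕ → Ω → Bool) (hX : CoinGame.IsFairCoin μ X) (n : ℕ) (hn : 3 ≤ n) :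
    CoinGame.deltaE μ X n =
        ENNReal.ofReal (∑ k ∈ Finset.Icc 1 (n - 1),
          ((CoinGame.eulerian (n - 1) (k - 1) : ℝ) / ((n - 1).factorial : ℝ)) *
            ((k : ℝ) * ((n : ℝ) - (k : ℝ)))) ∧
      CoinGame.deltaE μ X n =
        ENNReal.ofReal ((1 / ((n - 1).factorial : ℝ)) * ∑ k ∈ Finset.Icc 1 (n - 1),
          (CoinGame.eulerian (n - 1) (k - 1) : ℝ) * ((k : ℝ) * ((n : ℝ) - (k : ℝ)))) := by
  obtain ⟨m, rfl⟩ : ∃ m, n = m + 1 + 1 := ⟨n - 2, by omega⟩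
  have hmain : CoinGame.deltaE μ X (m + 1 + 1) =
      ENNReal.ofReal ((1 / ((m + 1 + 1 - 1).factorial : ℝ)) *
        ∑ k ∈ Finset.Icc 1 (m + 1 + 1 - 1), (CoinGame.eulerian (m + 1 + 1 - 1) (k - 1) : ℝ) *
          ((k : ℝ) * (((m + 1 + 1 : ℕ) : ℝ) - (k : ℝ)))) := by
    rw [hX.deltaE_eq_potential (by omega), Nat.add_sub_cancel, CoinGame.potential_start,
      CoinGame.sum_eulerian_eq_meanTosses, ← mul_assoc,
      one_div_mul_cancel (by exact_mod_cast Nat.factorial_ne_zero _), one_mul]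
  refine ⟨?_, hmain⟩
  rw [hmain, Finset.mul_sum]
  congr 1
  exact Finset.sum_congr rfl fun k _ => by ring
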